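/- Let $H$ and $\mathcal H$ be homogeneous Hilbertian operator spaces on $\ell_2$, i.e. operator space structures on the complex Hilbert space $\ell_2$ (inducing the usual norm of $\ell_2$) such that every bounded linear map $u$ of the space into itself satisfies $\|u\|_{cb}=\|u\|$. Let $(e_k)$ be the unit vectors of $\ell_2$. For $n\in\mathbb N$ and a bounded linear map $v$ from an operator space $E$ to $\ell_2^n$ put $$\pi_{2,H}(v)=\sup\Big\{\frac{(\sum_k\|vx_k\|^2)^{1/2}}{\|\sum_k x_k\otimes e_k\|_{E\otimes_{\min}H}}\Big\},\qquad \ell^*(v)=\sup\{|\mathrm{tr}(vu)| : u:\ell_2^n\to E,\ \ell(u)\le 1\},$$ where the first supremum runs over all finite families $(x_k)$ in $E$ (with $0/0=0$), and $\ell(u)=\big(\int\|\sum_{k=1}^n g_k\,ue_k\|^2\,dP\big)^{1/2}$ for independent standard Gaussian variables $g_k$. The operator space $E$ has cotype $(2,H)$ if there is a constant $C>0$ with $\ell^*(v)\le C\,\pi_{2,H}(v)$ for all $n\in\mathbb N$ and all bounded linear $v:E\to\ell_2^n$. Let $H^*$ be the operator space dual of $H$. Then $\mathcal H$ has cotype $(2,H)$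 if and only if the formal identity $H^*\to\mathcal H$, $\varphi\mapsto(\varphi(e_k))_k$, is completely bounded. -/

import Mathlib

open scoped ENNReal NNReal InnerProductSpace TensorProduct Kronecker

noncomputable section

/-- The sequence space `ℓ₂` over the complex numbers. -/
abbrev ellTwo : Type := lp (fun _ : ℕ => ℂ) 2

/-- The unit vectors `e_k` of `ℓ₂`. -/
def ellTwoBasis (k : ℕ) : ellTwo := lp.single 2 k (1 : ℂ)

namespace OpSpace

universe u v

/-- The operator on the Hilbert space `K^n` given by an `n × n` matrix of operators on `K`. -/
def blockOp {K : Type*} [NormedAddCommGroup K] [InnerProductSpace ℂ K] {n : ℕ}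
    (a : Matrix (Fin n) (Fin n) (K →L[ℂ] K)) :
    PiLp 2 (fun _ : Fin n => K) →L[ℂ] PiLp 2 (fun _ : Fin n => K) :=
  ((PiLp.continuousLinearEquiv 2 ℂ (fun _ : Fin n => K)).symm :
      (Fin n → K) →L[ℂ] PiLp 2 (fun _ : Fin n => K)) ∘L
    ContinuousLinearMap.pi (fun i => ∑ j, a i j ∘L PiLp.proj 2 (fun _ : Fin n => K) j)

lemma blockOp_apply {K : Type*} [NormedAddCommGroup K] [InnerProductSpace ℂ K] {n : ℕ}
    (a : Matrix (Fin n) (Fin n) (K →L[ℂ] K)) (ξ : PiLp 2 (fun _ : Fin n => K)) (i : Fin n) :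
    blockOp a ξ i = ∑ j, a i j (ξ j) := by
  simp [blockOp]

/-- A family of (extended) norms on the matrix spaces `M_n(E)`, `n = 0, 1, 2, …`. -/
abbrev MatrixNorms (E : Type u) : Type u := (n : ℕ) → Matrix (Fin n) (Fin n) E → ℝ≥0∞

/-- An operator space structure on a normed space `E`: an isometric linear embedding of `E` into
the space `B(K)` of bounded operators on a complex Hilbert space `K`. -/
structure OperatorSpaceStructure (E : Type u) [NormedAddCommGroup E] [NormedSpace ℂ E] where
  /-- the Hilbert space `K` -/
  K : Type v
  [instNormedAddCommGroup : NormedAddCommGroup K]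
  [instInnerProductSpace : InnerProductSpace ℂ K]
  [instCompleteSpace : CompleteSpace K]
  /-- the embedding of `E` into `B(K)` -/
  rep : E →ₗᵢ[ℂ] (K →L[ℂ] K)

attribute [instance] OperatorSpaceStructure.instNormedAddCommGroup
  OperatorSpaceStructure.instInnerProductSpace OperatorSpaceStructure.instCompleteSpace

/-- The matrix norms of an operator space: `M_n(E)` is normed as a subspace of
`M_n(B(K)) = B(K^n)`. -/
def OperatorSpaceStructure.norms {E : Type u} [NormedAddCommGroup E] [NormedSpace ℂ E]
    (S : OperatorSpaceStructure.{u, v} E) : MatrixNorms E :=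
  fun _ x => ‖blockOp (x.map fun e => S.rep e)‖ₑ

/-- The matrix norms of the operator space `M_p = B(ℓ₂^p)`. -/
def matrixAlgebraNorms (p : ℕ) : MatrixNorms (Matrix (Fin p) (Fin p) ℂ) :=
  fun _ x => ‖blockOp (x.map fun a => Matrix.toEuclideanCLM (n := Fin p) (𝕜 := ℂ) a)‖ₑ

/-- The completely bounded norm `sup_n ‖u_n : M_n(E) → M_n(F)‖`, with values in `[0, ∞]`. -/
def cbNorm {E F : Type*} [AddCommGroup E] [Module ℂ E] [AddCommGroup F] [Module ℂ F]
    (N : MatrixNorms E) (N' : MatrixNorms F) (u : E →ₗ[ℂ] F) : ℝ≥0∞ :=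
  ⨆ (n : ℕ) (x : Matrix (Fin n) (Fin n) E) (_ : N n x ≤ 1), N' n (x.map u)

/-- A linear map is completely bounded if its completely bounded norm is finite. -/
def IsCompletelyBounded {E F : Type*} [AddCommGroup E] [Module ℂ E] [AddCommGroup F] [Module ℂ F]
    (N : MatrixNorms E) (N' : MatrixNorms F) (u : E →ₗ[ℂ] F) : Prop :=
  cbNorm N N' u < ∞

section Dual

variable {E : Type u} [NormedAddCommGroup E] [NormedSpace ℂ E]

/-- The linear map `x ↦ [φ_{ij}(x)]` from `E` to `M_n` given by a matrix of functionals. -/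
def matrixOfFunctionals {n : ℕ} (φ : Matrix (Fin n) (Fin n) (StrongDual ℂ E)) :
    E →ₗ[ℂ] Matrix (Fin n) (Fin n) ℂ where
  toFun x := Matrix.of fun i j => φ i j x
  map_add' x y := by ext i j; simp
  map_smul' c x := by ext i j; simp

/-- The operator space dual `E*`: the matrix norms are those of `M_n(E*) = CB(E, M_n)`. -/
def OperatorSpaceStructure.dualNorms (S : OperatorSpaceStructure.{u, v} E) :
    MatrixNorms (StrongDual ℂ E) :=
  fun n φ => cbNorm S.norms (matrixAlgebraNorms n) (matrixOfFunctionals φ)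

end Dual

/-- The injective (minimal) operator space tensor norm of `z ∈ E ⊗ F`: the supremum of
`‖(f ⊗ g)(z)‖` in `M_p ⊗ M_q = M_{pq}` over all complete contractions `f : E → M_p` and
`g : F → M_q`. -/
def minNorm {E F : Type*} [AddCommGroup E] [Module ℂ E] [AddCommGroup F] [Module ℂ F]
    (N : MatrixNorms E) (N' : MatrixNorms F) (z : E ⊗[ℂ] F) : ℝ≥0∞ :=
  ⨆ (p : ℕ) (q : ℕ) (f : E →ₗ[ℂ] Matrix (Fin p) (Fin p) ℂ)
    (g : F →ₗ[ℂ] Matrix (Fin q) (Fin q) ℂ)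
    (_ : cbNorm N (matrixAlgebraNorms p) f ≤ 1) (_ : cbNorm N' (matrixAlgebraNorms q) g ≤ 1),
    ‖Matrix.toEuclideanCLM (n := Fin p × Fin q) (𝕜 := ℂ)
      (TensorProduct.lift ((Matrix.kroneckerMapBilinear (LinearMap.mul ℂ ℂ)).compl₁₂ f g) z)‖ₑ

/-- A Hilbertian operator space (an operator space structure on `ℓ₂`) is homogeneous if
`‖u‖_cb = ‖u‖` for every bounded operator `u` on it. -/
def IsHomogeneous (S : OperatorSpaceStructure.{0, v} ellTwo) : Prop :=
  ∀ u : ellTwo →L[ℂ] ellTwo, cbNorm S.norms S.norms (u : ellTwo →ₗ[ℂ] ellTwo) = ‖u‖ₑ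

section Cotype

variable {E : Type u} [NormedAddCommGroup E] [NormedSpace ℂ E]

/-- The `ℓ`-norm `ℓ(u) = (∫ ‖∑ g_k u(e_k)‖² dP)^{1/2}` of `u : ℓ₂^n → E`, where the `g_k` are
independent standard Gaussian variables. -/
def ellNorm {n : ℕ} (u : EuclideanSpace ℂ (Fin n) →L[ℂ] E) : ℝ≥0∞ :=
  (∫⁻ g : Fin n → ℝ, ‖∑ k, (g k : ℂ) • u (EuclideanSpace.single k 1)‖ₑ ^ 2
    ∂(MeasureTheory.Measure.pi fun _ : Fin n => ProbabilityTheory.gaussianReal 0 1)) ^ (1 / 2 : ℝ)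

/-- The adjoint `ℓ`-norm `ℓ*(v) = sup {|tr(vu)| : u : ℓ₂^n → E, ℓ(u) ≤ 1}` of `v : E → ℓ₂^n`. -/
def ellStar {n : ℕ} (v : E →L[ℂ] EuclideanSpace ℂ (Fin n)) : ℝ≥0∞ :=
  ⨆ (u : EuclideanSpace ℂ (Fin n) →L[ℂ] E) (_ : ellNorm u ≤ 1),
    ‖LinearMap.trace ℂ (EuclideanSpace ℂ (Fin n))
      (v ∘L u : EuclideanSpace ℂ (Fin n) →L[ℂ] EuclideanSpace ℂ (Fin n))‖ₑ

/-- The `(2,H)`-summing norm of `v : E → ℓ₂^n`, the supremum over all finite families `(x_k)` in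
`E` of `(∑ ‖v x_k‖²)^{1/2} / ‖∑ x_k ⊗ e_k‖`, the denominator taken in `E ⊗_min H`. -/
def piTwo (H : OperatorSpaceStructure.{0, v} ellTwo) (S : OperatorSpaceStructure E)
    {n : ℕ} (w : E →L[ℂ] EuclideanSpace ℂ (Fin n)) : ℝ≥0∞ :=
  ⨆ (m : ℕ) (x : Fin m → E),
    (∑ k, ‖w (x k)‖ₑ ^ 2) ^ (1 / 2 : ℝ) /
      minNorm S.norms H.norms (∑ k : Fin m, x k ⊗ₜ[ℂ] ellTwoBasis k)

/-- The operator space `E` has cotype `(2,H)`: there is a constant `C > 0` with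
`ℓ*(w) ≤ C π_{2,H}(w)` for all `n` and all `w : E → ℓ₂^n`. -/
def HasCotypeTwo (H : OperatorSpaceStructure.{0, v} ellTwo) (S : OperatorSpaceStructure E) :
    Prop :=
  ∃ C : ℝ≥0, 0 < C ∧ ∀ (n : ℕ) (w : E →L[ℂ] EuclideanSpace ℂ (Fin n)),
    ellStar w ≤ C * piTwo H S w

end Cotype

/-- The formal identity `φ ↦ (φ(e_k))_k` from the dual of `ℓ₂` to `ℓ₂`, sending the functional
biorthogonal to the unit vectors at `k` to `e_k`; see `formalIdentity_apply`. -/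
def formalIdentity : StrongDual ℂ ellTwo →ₗ[ℂ] ellTwo where
  toFun φ := star ((InnerProductSpace.toDual ℂ ellTwo).symm φ)
  map_add' φ ψ := by simp
  map_smul' c φ := by simp [map_smulₛₗ]

lemma formalIdentity_apply (φ : StrongDual ℂ ellTwo) (k : ℕ) :
    formalIdentity φ k = φ (ellTwoBasis k) := by
  have h : φ (ellTwoBasis k)
      = ⟪(InnerProductSpace.toDual ℂ ellTwo).symm φ, ellTwoBasis k⟫_ℂ := by simp
  rw [h, ellTwoBasis, lp.inner_single_right]
  simp [formalIdentity]

end OpSpace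

end

/-!
On the Hilbert space `ℓ₂` the `ℓ`-norm is the Hilbert–Schmidt norm (`ellNorm_eq`), so `𝓗` has
cotype `(2,H)` precisely when the Hilbert–Schmidt norm of every `w : ℓ₂ → ℓ₂^n` is at most a
constant times `π_{2,H}(w)`. On the other side, a tensor `∑ x_k ⊗ e_k` in `𝓗 ⊗_min H` stands for
the map `φ ↦ ∑ φ(e_k) x_k` from `H*` to `𝓗`, and its minimal norm is the completely bounded norm of
that map. Hence the formal identity is completely bounded if and only if the norms of its
truncations `I_n = ∑_{k<n} e_k ⊗ e_k` are bounded (`minNorm_le_cbNorm_formalIdentity` and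
`cbNorm_formalIdentity_le`).

If the formal identity has completely bounded norm `c`, then `‖∑ x_k ⊗ e_k‖ ≤ c` for every
orthonormal family `(x_k)`, by homogeneity of `𝓗`. Testing `π_{2,H}(w)` on an orthonormal basis of
the orthogonal complement of `ker w` shows that the Hilbert–Schmidt norm of `w` is at most
`c π_{2,H}(w)`.

Conversely, cotype `(2,H)` with constant `C`, applied to the projection `P_n` onto the first `n`
coordinates, gives a tensor `t = ∑ x_k ⊗ e_k` with `√n ‖t‖ ≤ 2C (∑ ‖P_n x_k‖²)^{1/2}`. Regard `t`
as an operator on `ℓ₂`. Its operator norm is at most its minimal norm, so homogeneity of `H`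
yields `‖t t*‖ ≤ ‖t‖²`. Compressing `t t*` to the first `n` coordinates and averaging its conjugates
by signed cyclic shifts, which act contractively by homogeneity of both spaces, produces
`(∑ ‖P_n x_k‖² / n) I_n` without increasing the norm (`mul_minNorm_le`). Therefore
`‖I_n‖ ≤ n ‖t‖² / ∑ ‖P_n x_k‖² ≤ (2C)²` for all `n`.
-/

namespace OpSpace

universe u v

lemma enorm_le_one_iff_norm_le_one {F : Type*} [SeminormedAddGroup F] {x : F} :
    ‖x‖ₑ ≤ 1 ↔ ‖x‖ ≤ 1 := by
  rw [← ofReal_norm, ENNReal.ofReal_le_one]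

/-! ### Norms of operator matrices -/

section Blocks

variable {K : Type*} [NormedAddCommGroup K] [InnerProductSpace ℂ K] {n : ℕ}

lemma inner_blockOp (a : Matrix (Fin n) (Fin n) (K →L[ℂ] K))
    (ζ ξ : PiLp 2 (fun _ : Fin n => K)) :
    inner ℂ ζ (blockOp a ξ) = ∑ i, ∑ j, inner ℂ (ζ i) (a i j (ξ j)) := by
  simp [PiLp.inner_apply, blockOp_apply, inner_sum]

lemma norm_le_of_norm_inner_le {T : K →L[ℂ] K} {M : ℝ} (hM : 0 ≤ M)
    (h : ∀ ζ ξ, ‖inner ℂ ζ (T ξ)‖ ≤ M * ‖ζ‖ * ‖ξ‖) : ‖T‖ ≤ M := by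
  refine T.opNorm_le_bound hM fun ξ => ?_
  have h1 := h (T ξ) ξ
  rw [inner_self_eq_norm_sq_to_K, norm_pow, RCLike.norm_ofReal, abs_norm] at h1
  rcases (norm_nonneg (T ξ)).eq_or_lt with h0 | h0
  · rw [← h0]; positivity
  · nlinarith

lemma norm_inner_apply_le (T : K →L[ℂ] K) (ζ ξ : K) :
    ‖inner ℂ ζ (T ξ)‖ ≤ ‖T‖ * ‖ζ‖ * ‖ξ‖ :=
  (norm_inner_le_norm _ _).trans (by
    nlinarith [mul_le_mul_of_nonneg_left (T.le_opNorm ξ) (norm_nonneg ζ)])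

lemma norm_blockOp_le {a : Matrix (Fin n) (Fin n) (K →L[ℂ] K)} {M : ℝ} (hM : 0 ≤ M)
    (h : ∀ ζ ξ : PiLp 2 (fun _ : Fin n => K),
      ‖∑ i, ∑ j, inner ℂ (ζ i) (a i j (ξ j))‖ ≤ M * ‖ζ‖ * ‖ξ‖) : ‖blockOp a‖ ≤ M :=
  norm_le_of_norm_inner_le hM fun ζ ξ => by rw [inner_blockOp]; exact h ζ ξ

lemma norm_sum_inner_le (a : Matrix (Fin n) (Fin n) (K →L[ℂ] K))
    (ζ ξ : PiLp 2 (fun _ : Fin n => K)) :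
    ‖∑ i, ∑ j, inner ℂ (ζ i) (a i j (ξ j))‖ ≤ ‖blockOp a‖ * ‖ζ‖ * ‖ξ‖ := by
  rw [← inner_blockOp]; exact norm_inner_apply_le _ _ _

lemma norm_entry_le (a : Matrix (Fin n) (Fin n) (K →L[ℂ] K)) (i j : Fin n) :
    ‖a i j‖ ≤ ‖blockOp a‖ := by
  refine norm_le_of_norm_inner_le (norm_nonneg (blockOp a)) fun ζ ξ => ?_
  have h := norm_sum_inner_le a (PiLp.single 2 i ζ) (PiLp.single 2 j ξ)
  rw [PiLp.norm_single, PiLp.norm_single] at h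
  convert h using 2
  rw [Finset.sum_eq_single i, Finset.sum_eq_single j]
  · simp
  · intro k _ hk; simp [hk]
  · simp
  · intro k _ hk; simp [hk]
  · simp

lemma norm_blockOp_fin_one (T : K →L[ℂ] K) : ‖blockOp (n := 1) fun _ _ => T‖ ≤ ‖T‖ := by
  refine norm_blockOp_le (norm_nonneg _) fun ζ ξ => ?_
  have h := norm_inner_apply_le T (ζ 0) (ξ 0)
  simp only [Finset.univ_unique, Finset.sum_singleton, Fin.default_eq_zero]
  refine h.trans ?_
  gcongr <;> exact PiLp.norm_apply_le _ _

lemma norm_toLp_map {K' : Type*} [NormedAddCommGroup K'] [InnerProductSpace ℂ K']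
    (J : K' →ₗᵢ[ℂ] K) (ξ : PiLp 2 (fun _ : Fin n => K')) :
    ‖(WithLp.toLp 2 fun i => J (ξ i) : PiLp 2 (fun _ : Fin n => K))‖ = ‖ξ‖ := by
  simp [PiLp.norm_eq_of_L2]

lemma norm_toLp_smul (c : EuclideanSpace ℂ (Fin n)) (h : K) :
    ‖(WithLp.toLp 2 fun i => c i • h : PiLp 2 (fun _ : Fin n => K))‖ = ‖c‖ * ‖h‖ := by
  simp only [PiLp.norm_eq_of_L2, norm_smul, mul_pow, ← Finset.sum_mul]
  rw [Real.sqrt_mul (by positivity), Real.sqrt_sq (norm_nonneg _)]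

/-- `M_q(M_p) = M_{pq}`: a matrix with entries in `M_p` acts on `⊕_q ℓ₂^p` as the corresponding
scalar matrix acts on `ℓ₂^{p × q}`. -/
lemma norm_blockOp_matrix {p q : ℕ} (A : Matrix (Fin q) (Fin q) (Matrix (Fin p) (Fin p) ℂ)) :
    ‖blockOp (A.map fun a => Matrix.toEuclideanCLM (n := Fin p) (𝕜 := ℂ) a)‖ =
      ‖Matrix.toEuclideanCLM (n := Fin p × Fin q) (𝕜 := ℂ)
        (Matrix.of fun i j => A i.2 j.2 i.1 j.1)‖ := by
  set M : Matrix (Fin p × Fin q) (Fin p × Fin q) ℂ := Matrix.of fun i j => A i.2 j.2 i.1 j.1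
  have key : ∀ ζ ξ : PiLp 2 (fun _ : Fin q => EuclideanSpace ℂ (Fin p)),
      ∑ a, ∑ b, inner ℂ (ζ a) (Matrix.toEuclideanCLM (n := Fin p) (𝕜 := ℂ) (A a b) (ξ b)) =
      inner ℂ (WithLp.toLp 2 fun i => ζ i.2 i.1 : EuclideanSpace ℂ (Fin p × Fin q))
        (Matrix.toEuclideanCLM (n := Fin p × Fin q) (𝕜 := ℂ) M
          (WithLp.toLp 2 fun i => ξ i.2 i.1)) := by
    intro ζ ξ
    simp only [PiLp.inner_apply, Matrix.ofLp_toEuclideanCLM, Matrix.mulVec, dotProduct,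
      RCLike.inner_apply, Fintype.sum_prod_type, M, Matrix.of_apply, Finset.sum_mul]
    conv_rhs => rw [Finset.sum_comm]
    refine Finset.sum_congr rfl fun a _ => ?_
    rw [Finset.sum_comm]
    refine Finset.sum_congr rfl fun i _ => ?_
    rw [Finset.sum_comm]
  have hn : ∀ ζ : PiLp 2 (fun _ : Fin q => EuclideanSpace ℂ (Fin p)),
      ‖(WithLp.toLp 2 fun i => ζ i.2 i.1 : EuclideanSpace ℂ (Fin p × Fin q))‖ = ‖ζ‖ := by
    intro ζ
    simp only [PiLp.norm_eq_of_L2, Fintype.sum_prod_type]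
    rw [Finset.sum_comm]
    congr 1
    refine Finset.sum_congr rfl fun a _ => ?_
    rw [Real.sq_sqrt (by positivity)]
  apply le_antisymm
  · refine norm_blockOp_le (norm_nonneg _) fun ζ ξ => ?_
    simp only [Matrix.map_apply]
    rw [key, ← hn ζ, ← hn ξ]
    exact norm_inner_apply_le _ _ _
  · refine norm_le_of_norm_inner_le (norm_nonneg _) fun ζ ξ => ?_
    obtain ⟨ζ, rfl⟩ : ∃ ζ' : PiLp 2 (fun _ : Fin q => EuclideanSpace ℂ (Fin p)),
        WithLp.toLp 2 (fun i : Fin p × Fin q => ζ' i.2 i.1) = ζ :=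
      ⟨WithLp.toLp 2 fun a => WithLp.toLp 2 fun i => ζ (i, a), rfl⟩
    obtain ⟨ξ, rfl⟩ : ∃ ξ' : PiLp 2 (fun _ : Fin q => EuclideanSpace ℂ (Fin p)),
        WithLp.toLp 2 (fun i : Fin p × Fin q => ξ' i.2 i.1) = ξ :=
      ⟨WithLp.toLp 2 fun a => WithLp.toLp 2 fun i => ξ (i, a), rfl⟩
    rw [← key, hn, hn]
    exact norm_sum_inner_le (A.map fun a => Matrix.toEuclideanCLM (n := Fin p) (𝕜 := ℂ) a) ζ ξ

end Blocks

/-! ### Complete contractions into matrix algebras -/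

section Complete

variable {E : Type u} [NormedAddCommGroup E] [NormedSpace ℂ E]
  (S : OperatorSpaceStructure.{u, v} E)

lemma OperatorSpaceStructure.norms_one_le (x : E) : S.norms 1 (fun _ _ => x) ≤ ‖x‖ₑ := by
  have h := norm_blockOp_fin_one (S.rep x)
  rw [S.rep.norm_map] at h
  unfold OperatorSpaceStructure.norms
  rw [← ofReal_norm, ← ofReal_norm]
  exact ENNReal.ofReal_le_ofReal h

lemma apply_le_cbNorm {E F : Type*} [AddCommGroup E] [Module ℂ E] [AddCommGroup F] [Module ℂ F]
    {N : MatrixNorms E} {N' : MatrixNorms F} (u : E →ₗ[ℂ] F) {n : ℕ}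
    {x : Matrix (Fin n) (Fin n) E} (hx : N n x ≤ 1) : N' n (x.map u) ≤ cbNorm N N' u :=
  le_iSup_of_le n (le_iSup_of_le x (le_iSup_of_le hx le_rfl))

lemma cbNorm_le {E F : Type*} [AddCommGroup E] [Module ℂ E] [AddCommGroup F] [Module ℂ F]
    {N : MatrixNorms E} {N' : MatrixNorms F} {u : E →ₗ[ℂ] F} {C : ℝ≥0∞}
    (h : ∀ n (x : Matrix (Fin n) (Fin n) E), N n x ≤ 1 → N' n (x.map u) ≤ C) :
    cbNorm N N' u ≤ C :=
  iSup_le fun n => iSup_le fun x => iSup_le fun hx => h n x hx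

lemma cbNorm_comp_le_one {E F G : Type*} [AddCommGroup E] [Module ℂ E] [AddCommGroup F]
    [Module ℂ F] [AddCommGroup G] [Module ℂ G]
    {N : MatrixNorms E} {N' : MatrixNorms F} {N'' : MatrixNorms G} {f : F →ₗ[ℂ] G} {a : E →ₗ[ℂ] F}
    (hf : cbNorm N' N'' f ≤ 1) (ha : cbNorm N N' a ≤ 1) : cbNorm N N'' (f ∘ₗ a) ≤ 1 :=
  cbNorm_le fun _ x hx =>
    (apply_le_cbNorm f (x := x.map a) ((apply_le_cbNorm a hx).trans ha)).trans hf

/-- A functional `f` of norm at most one, as a map into `M_1`. It is a complete contraction since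
`∑ ζ̄_i f(x_ij) ξ_j` is the value of `f` at `∑ ζ̄_i ξ_j x_ij`, whose norm is at most
`‖x‖ ‖ζ‖ ‖ξ‖`. -/
lemma cbNorm_functional_le_one (f : StrongDual ℂ E) (hf : ‖f‖ ≤ 1) :
    cbNorm S.norms (matrixAlgebraNorms 1)
      ((f : E →ₗ[ℂ] ℂ).smulRight (1 : Matrix (Fin 1) (Fin 1) ℂ)) ≤ 1 := by
  refine cbNorm_le fun n x hx => ?_
  unfold matrixAlgebraNorms
  unfold OperatorSpaceStructure.norms at hx
  rw [enorm_le_one_iff_norm_le_one] at hx ⊢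
  refine norm_blockOp_le zero_le_one fun ζ ξ => ?_
  have e1 : ∀ ζ : PiLp 2 (fun _ : Fin n => EuclideanSpace ℂ (Fin 1)),
      ‖(WithLp.toLp 2 fun i => ζ i 0 : EuclideanSpace ℂ (Fin n))‖ = ‖ζ‖ := by
    intro ζ
    simp [PiLp.norm_eq_of_L2]
  have e2 : ∑ i, ∑ j, inner ℂ (ζ i) (Matrix.toEuclideanCLM (n := Fin 1) (𝕜 := ℂ)
      (((f : E →ₗ[ℂ] ℂ).smulRight (1 : Matrix (Fin 1) (Fin 1) ℂ)) (x i j)) (ξ j)) =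
      f (∑ i, ∑ j, (star (ζ i 0) * ξ j 0) • x i j) := by
    simp only [map_sum, LinearMap.smulRight_apply, map_smul, map_one]
    refine Finset.sum_congr rfl fun i _ => Finset.sum_congr rfl fun j _ => ?_
    simp [PiLp.inner_apply]
    ring
  have e3 : ‖∑ i, ∑ j, (star (ζ i 0) * ξ j 0) • x i j‖ ≤ ‖ζ‖ * ‖ξ‖ := by
    rw [← S.rep.norm_map]
    refine norm_le_of_norm_inner_le (by positivity) fun k h => ?_
    have := norm_sum_inner_le (x.map fun e => S.rep e)
      (WithLp.toLp 2 fun i => ζ i 0 • k) (WithLp.toLp 2 fun i => ξ i 0 • h)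
    have n1 := norm_toLp_smul (WithLp.toLp 2 fun i => ζ i 0 : EuclideanSpace ℂ (Fin n)) k
    have n2 := norm_toLp_smul (WithLp.toLp 2 fun i => ξ i 0 : EuclideanSpace ℂ (Fin n)) h
    rw [e1] at n1 n2
    rw [n1, n2] at this
    calc _ = ‖∑ i, ∑ j, inner ℂ (ζ i 0 • k) (S.rep (x i j) (ξ j 0 • h))‖ := by
          congr 1
          simp only [map_sum, sum_apply, inner_sum, map_smul,
            smul_apply, inner_smul_left, inner_smul_right]
          refine Finset.sum_congr rfl fun i _ => Finset.sum_congr rfl fun j _ => ?_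
          simp; ring
      _ ≤ _ := this
      _ ≤ 1 * (‖ζ‖ * ‖k‖) * (‖ξ‖ * ‖h‖) := by gcongr
      _ = _ := by ring
  simp only [Matrix.map_apply]
  rw [e2]
  calc _ ≤ ‖f‖ * _ := f.le_opNorm _
    _ ≤ 1 * (‖ζ‖ * ‖ξ‖) := by gcongr
    _ = _ := by ring

/-- The compression `x ↦ J* x J` of an operator space in `B(K)` to `M_p = B(ℓ₂^p)`, for an
isometry `J : ℓ₂^p → K`. -/
noncomputable def compression {p : ℕ} (J : EuclideanSpace ℂ (Fin p) →ₗᵢ[ℂ] S.K) :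
    E →ₗ[ℂ] Matrix (Fin p) (Fin p) ℂ where
  toFun x := (Matrix.toEuclideanCLM (n := Fin p) (𝕜 := ℂ)).symm
    (ContinuousLinearMap.adjoint J.toContinuousLinearMap ∘L S.rep x ∘L J.toContinuousLinearMap)
  map_add' x y := by
    simp [ContinuousLinearMap.comp_add, ContinuousLinearMap.add_comp]
  map_smul' c x := by
    simp [ContinuousLinearMap.smul_comp]

lemma inner_compression {p : ℕ} (J : EuclideanSpace ℂ (Fin p) →ₗᵢ[ℂ] S.K) (x : E)
    (ζ ξ : EuclideanSpace ℂ (Fin p)) :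
    inner ℂ ζ (Matrix.toEuclideanCLM (n := Fin p) (𝕜 := ℂ) (compression S J x) ξ) =
      inner ℂ (J ζ) (S.rep x (J ξ)) := by
  simp [compression, ContinuousLinearMap.adjoint_inner_right]

lemma cbNorm_compression_le_one {p : ℕ} (J : EuclideanSpace ℂ (Fin p) →ₗᵢ[ℂ] S.K) :
    cbNorm S.norms (matrixAlgebraNorms p) (compression S J) ≤ 1 := by
  refine cbNorm_le fun n x hx => ?_
  unfold matrixAlgebraNorms
  unfold OperatorSpaceStructure.norms at hx
  rw [enorm_le_one_iff_norm_le_one] at hx ⊢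
  refine norm_blockOp_le zero_le_one fun ζ ξ => ?_
  simp only [Matrix.map_apply, inner_compression]
  have := norm_sum_inner_le (x.map fun e => S.rep e)
      (WithLp.toLp 2 fun i => J (ζ i)) (WithLp.toLp 2 fun i => J (ξ i))
  rw [norm_toLp_map, norm_toLp_map] at this
  exact this.trans (by gcongr)

/-- The norm of `M_n(E)` is determined by the complete contractions of `E` into matrix algebras,
since vectors in `K^n` have finitely many coordinates and compressing to their span is a complete
contraction. -/
lemma norm_sum_inner_rep_le {n : ℕ} {x : Matrix (Fin n) (Fin n) E} {M : ℝ}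
    (h : ∀ (p : ℕ) (f : E →ₗ[ℂ] Matrix (Fin p) (Fin p) ℂ),
      cbNorm S.norms (matrixAlgebraNorms p) f ≤ 1 →
      ‖blockOp ((x.map f).map fun a => Matrix.toEuclideanCLM (n := Fin p) (𝕜 := ℂ) a)‖ ≤ M)
    (ζ ξ : PiLp 2 (fun _ : Fin n => S.K)) :
    ‖∑ i, ∑ j, inner ℂ (ζ i) (S.rep (x i j) (ξ j))‖ ≤ M * ‖ζ‖ * ‖ξ‖ := by
  -- The finitely many coordinates of `ζ` and `ξ` span the range of an isometry `J`.
  let V : Submodule ℂ S.K := Submodule.span ℂ (Set.range ζ.ofLp ∪ Set.range ξ.ofLp)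
  have : FiniteDimensional ℂ V := FiniteDimensional.span_of_finite ℂ
    ((Set.finite_range _).union (Set.finite_range _))
  let b := stdOrthonormalBasis ℂ V
  let J : EuclideanSpace ℂ (Fin (Module.finrank ℂ V)) →ₗᵢ[ℂ] S.K :=
    V.subtypeₗᵢ.comp b.repr.symm.toLinearIsometry
  have hJ : ∀ y (hy : y ∈ V), J (b.repr ⟨y, hy⟩) = y := by intro y hy; simp [J]
  have hζ : ∀ i, ζ i ∈ V := fun i => Submodule.subset_span (Or.inl ⟨i, rfl⟩)
  have hξ : ∀ i, ξ i ∈ V := fun i => Submodule.subset_span (Or.inr ⟨i, rfl⟩)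
  have key := norm_sum_inner_le
    ((x.map (compression S J)).map fun a => Matrix.toEuclideanCLM (n := Fin _) (𝕜 := ℂ) a)
    (WithLp.toLp 2 fun i => b.repr ⟨ζ i, hζ i⟩) (WithLp.toLp 2 fun i => b.repr ⟨ξ i, hξ i⟩)
  rw [← norm_toLp_map J, ← norm_toLp_map J] at key
  simp only [Matrix.map_apply, inner_compression, hJ] at key
  refine key.trans ?_
  have := h _ _ (cbNorm_compression_le_one S J)
  change _ * ‖ζ‖ * ‖ξ‖ ≤ _
  gcongr

lemma blockOp_smul {K : Type*} [NormedAddCommGroup K] [InnerProductSpace ℂ K] {n : ℕ} (c : ℂ)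
    (a : Matrix (Fin n) (Fin n) (K →L[ℂ] K)) : blockOp (c • a) = c • blockOp a := by
  ext ξ i
  simp [blockOp_apply, Finset.smul_sum]

/-- Complete contractions do not increase the norm of any matrix, not only of those in the unit
ball. -/
lemma norms_map_le {p n : ℕ} {f : E →ₗ[ℂ] Matrix (Fin p) (Fin p) ℂ}
    (hf : cbNorm S.norms (matrixAlgebraNorms p) f ≤ 1) (x : Matrix (Fin n) (Fin n) E) :
    matrixAlgebraNorms p n (x.map f) ≤ S.norms n x := by
  unfold matrixAlgebraNorms OperatorSpaceStructure.norms
  rw [enorm_le_iff_norm_le]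
  refine le_of_forall_gt_imp_ge_of_dense fun t ht => ?_
  have t0 : 0 < t := (norm_nonneg _).trans_lt ht
  have hc : ‖(t⁻¹ : ℂ)‖ = t⁻¹ := by simp [abs_of_pos t0]
  have h1 : S.norms n ((t⁻¹ : ℂ) • x) ≤ 1 := by
    unfold OperatorSpaceStructure.norms
    have : (((t⁻¹ : ℂ) • x).map fun e => S.rep e) = (t⁻¹ : ℂ) • x.map fun e => S.rep e := by
      ext1 i j; simp
    rw [this, blockOp_smul, enorm_le_one_iff_norm_le_one, norm_smul, hc,
      inv_mul_le_iff₀ t0, mul_one]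
    exact ht.le
  have h2 := (apply_le_cbNorm (N' := matrixAlgebraNorms p) f h1).trans hf
  unfold matrixAlgebraNorms at h2
  have : ((((t⁻¹ : ℂ) • x).map f).map fun a => Matrix.toEuclideanCLM (n := Fin p) (𝕜 := ℂ) a) =
      (t⁻¹ : ℂ) • (x.map f).map fun a => Matrix.toEuclideanCLM (n := Fin p) (𝕜 := ℂ) a := by
    ext1 i j; simp
  rwa [this, blockOp_smul, enorm_le_one_iff_norm_le_one, norm_smul, hc,
      inv_mul_le_iff₀ t0, mul_one] at h2

/-- A complete contraction into a matrix algebra has bounded entries. -/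
lemma norm_entry_apply_le {q : ℕ} {g : E →ₗ[ℂ] Matrix (Fin q) (Fin q) ℂ}
    (hg : cbNorm S.norms (matrixAlgebraNorms q) g ≤ 1) (i j : Fin q) (x : E) :
    ‖g x i j‖ ≤ 1 * ‖x‖ := by
  have h1 : ∀ y : E, ‖y‖ ≤ 1 → ‖g y i j‖ ≤ 1 := by
    intro y hy
    have h2 : S.norms 1 (fun _ _ => y) ≤ 1 :=
      (S.norms_one_le y).trans (enorm_le_one_iff_norm_le_one.2 hy)
    have h3 := (apply_le_cbNorm (N' := matrixAlgebraNorms q) g h2).trans hg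
    unfold matrixAlgebraNorms at h3
    rw [enorm_le_one_iff_norm_le_one] at h3
    have h4 := (norm_entry_le _ 0 0).trans h3
    have h5 := norm_inner_apply_le (Matrix.toEuclideanCLM (n := Fin q) (𝕜 := ℂ) (g y))
      (EuclideanSpace.single i 1) (EuclideanSpace.single j 1)
    have h6 : inner ℂ (EuclideanSpace.single i (1 : ℂ))
      (Matrix.toEuclideanCLM (n := Fin q) (𝕜 := ℂ) (g y) (EuclideanSpace.single j 1)) =
        g y i j := by
      simp [EuclideanSpace.inner_single_left]
    rw [h6] at h5
    simp only [PiLp.norm_single, norm_one, mul_one] at h5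
    exact h5.trans h4
  rcases eq_or_ne x 0 with rfl | hx
  · simp
  · have h0 : 0 < ‖x‖ := norm_pos_iff.2 hx
    have := h1 ((‖x‖⁻¹ : ℂ) • x) (by
      rw [norm_smul]; simp [h0.ne'])
    rw [map_smul, Matrix.smul_apply, norm_smul] at this
    simp only [norm_inv, Complex.norm_real, norm_norm] at this
    rw [one_mul]
    rwa [inv_mul_le_iff₀ h0, mul_one] at this

/-- A complete contraction into `M_q` comes from a matrix in `M_q(E*)`, which then lies in the unit
ball by the definition of the dual operator space structure. -/
lemma exists_matrixOfFunctionals_eq {q : ℕ} {g : E →ₗ[ℂ] Matrix (Fin q) (Fin q) ℂ}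
    (hg : cbNorm S.norms (matrixAlgebraNorms q) g ≤ 1) :
    ∃ γ : Matrix (Fin q) (Fin q) (StrongDual ℂ E), matrixOfFunctionals γ = g := by
  refine ⟨Matrix.of fun i j => LinearMap.mkContinuous
    { toFun := fun x => g x i j, map_add' := by simp, map_smul' := by simp } 1
      (norm_entry_apply_le S hg i j), ?_⟩
  ext x i j
  simp [matrixOfFunctionals]

end Complete

/-! ### The minimal tensor norm -/

section MinNorm

variable {E F : Type*} [AddCommGroup E] [Module ℂ E] [AddCommGroup F] [Module ℂ F]
  {N : MatrixNorms E} {N' : MatrixNorms F}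

/-- The matrix `(f ⊗ g)(z)`, for matrix-valued maps `f` and `g`. -/
noncomputable abbrev matrixTensor {p q : ℕ} (f : E →ₗ[ℂ] Matrix (Fin p) (Fin p) ℂ)
    (g : F →ₗ[ℂ] Matrix (Fin q) (Fin q) ℂ) :
    E ⊗[ℂ] F →ₗ[ℂ] Matrix (Fin p × Fin q) (Fin p × Fin q) ℂ :=
  TensorProduct.lift ((Matrix.kroneckerMapBilinear (LinearMap.mul ℂ ℂ)).compl₁₂ f g)

lemma le_minNorm {p q : ℕ} {f : E →ₗ[ℂ] Matrix (Fin p) (Fin p) ℂ}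
    {g : F →ₗ[ℂ] Matrix (Fin q) (Fin q) ℂ} (hf : cbNorm N (matrixAlgebraNorms p) f ≤ 1)
    (hg : cbNorm N' (matrixAlgebraNorms q) g ≤ 1) (z : E ⊗[ℂ] F) :
    ‖Matrix.toEuclideanCLM (n := Fin p × Fin q) (𝕜 := ℂ) (matrixTensor f g z)‖ₑ
      ≤ minNorm N N' z :=
  le_iSup_of_le p (le_iSup_of_le q (le_iSup_of_le f (le_iSup_of_le g
    (le_iSup_of_le hf (le_iSup_of_le hg le_rfl)))))

lemma minNorm_le {z : E ⊗[ℂ] F} {C : ℝ≥0∞}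
    (h : ∀ (p q : ℕ) (f : E →ₗ[ℂ] Matrix (Fin p) (Fin p) ℂ)
      (g : F →ₗ[ℂ] Matrix (Fin q) (Fin q) ℂ), cbNorm N (matrixAlgebraNorms p) f ≤ 1 →
      cbNorm N' (matrixAlgebraNorms q) g ≤ 1 →
      ‖Matrix.toEuclideanCLM (n := Fin p × Fin q) (𝕜 := ℂ) (matrixTensor f g z)‖ₑ ≤ C) :
    minNorm N N' z ≤ C :=
  iSup_le fun p => iSup_le fun q => iSup_le fun f => iSup_le fun g => iSup_le fun hf =>
    iSup_le fun hg => h p q f g hf hg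

lemma minNorm_smul_le (c : ℂ) (z : E ⊗[ℂ] F) :
    minNorm N N' (c • z) ≤ ‖c‖ₑ * minNorm N N' z :=
  minNorm_le fun p q f g hf hg => by
    rw [map_smul, map_smul, enorm_smul]
    gcongr
    exact le_minNorm hf hg z

lemma minNorm_sum_le {ι : Type*} (s : Finset ι) (z : ι → E ⊗[ℂ] F) :
    minNorm N N' (∑ i ∈ s, z i) ≤ ∑ i ∈ s, minNorm N N' (z i) :=
  minNorm_le fun p q f g hf hg => by
    rw [map_sum, map_sum]
    refine (enorm_sum_le s fun i =>
      Matrix.toEuclideanCLM (n := Fin p × Fin q) (𝕜 := ℂ) (matrixTensor f g (z i))).trans (Finset.sum_le_sum fun i _ => ?_)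
    exact le_minNorm hf hg (z i)

/-- The matrix `(f ⊗ g)(∑ x_k ⊗ y_k)` in `M_p ⊗ M_q`, rearranged as the matrix over `M_p` with
entries `f(∑ g_{ab}(y_k) x_k)`. -/
lemma matrixTensor_sum {E F : Type*} [AddCommGroup E] [Module ℂ E] [NormedAddCommGroup F]
    [NormedSpace ℂ F] {p q m : ℕ} (f : E →ₗ[ℂ] Matrix (Fin p) (Fin p) ℂ)
    (γ : Matrix (Fin q) (Fin q) (StrongDual ℂ F)) (x : Fin m → E) (y : Fin m → F) :
    matrixTensor f (matrixOfFunctionals γ) (∑ k, x k ⊗ₜ[ℂ] y k) =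
      Matrix.of fun i j =>
        ((Matrix.of fun a b => ∑ k, γ a b (y k) • x k).map f) i.2 j.2 i.1 j.1 := by
  ext i j
  simp only [matrixTensor, map_sum, TensorProduct.lift.tmul, LinearMap.compl₁₂_apply,
    Matrix.sum_apply, Matrix.of_apply, Matrix.map_apply, map_smul, Matrix.smul_apply]
  refine Finset.sum_congr rfl fun k _ => ?_
  simp [matrixOfFunctionals, mul_comm]

/-- Complete contractions of the factors act contractively on the minimal tensor product. -/
lemma minNorm_map_le {a : E →ₗ[ℂ] E} {b : F →ₗ[ℂ] F} (ha : cbNorm N N a ≤ 1)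
    (hb : cbNorm N' N' b ≤ 1) (z : E ⊗[ℂ] F) :
    minNorm N N' (TensorProduct.map a b z) ≤ minNorm N N' z :=
  minNorm_le fun p q f g hf hg => by
    have : matrixTensor f g (TensorProduct.map a b z) = matrixTensor (f ∘ₗ a) (g ∘ₗ b) z := by
      rw [← LinearMap.comp_apply]
      congr 1
      ext x y
      simp [matrixTensor]
    rw [this]
    exact le_minNorm (cbNorm_comp_le_one hf ha) (cbNorm_comp_le_one hg hb) z

end MinNorm

/-- The injective Banach space tensor norm is at most the minimal operator space tensor norm. -/
lemma enorm_sum_mul_le_minNorm {E : Type*} {F : Type*} [NormedAddCommGroup E] [NormedSpace ℂ E]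
    [NormedAddCommGroup F] [NormedSpace ℂ F] (S : OperatorSpaceStructure E)
    (T : OperatorSpaceStructure F) {f : StrongDual ℂ E} (hf : ‖f‖ ≤ 1) {g : StrongDual ℂ F}
    (hg : ‖g‖ ≤ 1) {m : ℕ} (x : Fin m → E) (y : Fin m → F) :
    ‖∑ k, f (x k) * g (y k)‖ₑ ≤ minNorm S.norms T.norms (∑ k, x k ⊗ₜ[ℂ] y k) := by
  refine le_trans (le_of_eq ?_) (le_minNorm (cbNorm_functional_le_one S f hf)
    (cbNorm_functional_le_one T g hg) _)
  have : matrixTensor ((f : E →ₗ[ℂ] ℂ).smulRight (1 : Matrix (Fin 1) (Fin 1) ℂ))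
      ((g : F →ₗ[ℂ] ℂ).smulRight (1 : Matrix (Fin 1) (Fin 1) ℂ)) (∑ k, x k ⊗ₜ[ℂ] y k) =
      (∑ k, f (x k) * g (y k)) • 1 := by
    simp only [matrixTensor, map_sum, TensorProduct.lift.tmul, LinearMap.compl₁₂_apply,
      LinearMap.smulRight_apply, map_smul, LinearMap.smul_apply, Finset.sum_smul, smul_smul]
    refine Finset.sum_congr rfl fun k _ => ?_
    congr 1
    · simp [mul_comm]
    · exact Matrix.one_kronecker_one
  rw [this, map_smul, map_one, enorm_smul, enorm_one, mul_one]

/-! ### The formal identity and its truncations -/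

section EllTwo

lemma inner_ellTwoBasis_left (k : ℕ) (x : ellTwo) : inner ℂ (ellTwoBasis k) x = x k := by
  rw [ellTwoBasis, lp.inner_single_left]; simp

lemma ellTwoBasis_apply (k j : ℕ) : ellTwoBasis k j = if j = k then 1 else 0 := by
  rw [ellTwoBasis, lp.single_apply]
  split_ifs with h
  · subst h; simp
  · simp [h]

lemma orthonormal_ellTwoBasis : Orthonormal ℂ ellTwoBasis := by
  rw [orthonormal_iff_ite]
  intro i j
  rw [inner_ellTwoBasis_left, ellTwoBasis_apply]

/-- The operator on `ℓ₂` that sends `e_k` to `v_k` for `k < n`, and to `0` otherwise. -/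
noncomputable def synthesis {n : ℕ} (v : Fin n → ellTwo) : ellTwo →L[ℂ] ellTwo :=
  ∑ i : Fin n, (lp.evalCLM ℂ (fun _ : ℕ => ℂ) 2 (i : ℕ)).smulRight (v i)

lemma synthesis_apply {n : ℕ} (v : Fin n → ellTwo) (y : ellTwo) :
    synthesis v y = ∑ i : Fin n, y i • v i := by
  simp [synthesis, lp.evalCLM]

lemma synthesis_basis {n : ℕ} (v : Fin n → ellTwo) (k : Fin n) :
    synthesis v (ellTwoBasis k) = v k := by
  rw [synthesis_apply, Finset.sum_eq_single k]
  · simp [ellTwoBasis_apply]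
  · intro j _ hj
    simp [ellTwoBasis_apply, Fin.val_inj, hj]
  · simp

lemma norm_synthesis_le_one {n : ℕ} {v : Fin n → ellTwo} (hv : Orthonormal ℂ v) :
    ‖synthesis v‖ ≤ 1 := by
  refine ContinuousLinearMap.opNorm_le_bound _ zero_le_one fun y => ?_
  rw [one_mul, ← sq_le_sq₀ (norm_nonneg _) (norm_nonneg _), synthesis_apply]
  have h1 : ‖∑ i : Fin n, y i • v i‖ ^ 2 = ∑ i : Fin n, ‖y i‖ ^ 2 := by
    have := hv.inner_sum (fun i : Fin n => y i) (fun i : Fin n => y i) Finset.univ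
    rw [inner_self_eq_norm_sq_to_K] at this
    have h2 := congrArg Complex.re this
    simp only [RCLike.conj_mul, Complex.re_sum] at h2
    norm_cast at h2
  have h3 : Orthonormal ℂ fun i : Fin n => ellTwoBasis i :=
    orthonormal_ellTwoBasis.comp _ Fin.val_injective
  have h4 := h3.sum_inner_products_le y (s := Finset.univ)
  simp only [inner_ellTwoBasis_left] at h4
  rw [h1]; exact h4

lemma tendsto_synthesis_ellTwoBasis (y : ellTwo) :
    Filter.Tendsto (fun m : ℕ => synthesis (fun k : Fin m => ellTwoBasis k) y) Filter.atTop
      (nhds y) := by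
  have h := (lp.hasSum_single (p := 2) (by simp) y).tendsto_sum_nat
  refine h.congr fun m => ?_
  rw [synthesis_apply, Finset.sum_range]
  refine Finset.sum_congr rfl fun i _ => ?_
  rw [ellTwoBasis, ← lp.single_smul]
  simp

lemma IsHomogeneous.cbNorm_le_one {S : OperatorSpaceStructure.{0, v} ellTwo}
    (hS : IsHomogeneous S) {a : ellTwo →L[ℂ] ellTwo} (ha : ‖a‖ ≤ 1) :
    cbNorm S.norms S.norms (a : ellTwo →ₗ[ℂ] ellTwo) ≤ 1 := by
  rw [hS a, enorm_le_one_iff_norm_le_one]; exact ha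

/-- The tensor `∑ x_k ⊗ e_k` represents the finite-rank map `φ ↦ ∑ φ(e_k) x_k` from `H*`, which is
the formal identity followed by an operator carrying the unit vectors to the orthonormal family
`(x_k)`. -/
lemma minNorm_le_cbNorm_formalIdentity {H : OperatorSpaceStructure ellTwo}
    {S : OperatorSpaceStructure ellTwo} (hS : IsHomogeneous S) {d : ℕ} {x : Fin d → ellTwo}
    (hx : Orthonormal ℂ x) :
    minNorm S.norms H.norms (∑ k : Fin d, x k ⊗ₜ[ℂ] ellTwoBasis k) ≤
      cbNorm H.dualNorms S.norms formalIdentity := by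
  refine minNorm_le fun p q f g hf hg => ?_
  obtain ⟨γ, rfl⟩ := exists_matrixOfFunctionals_eq H hg
  have hf' := cbNorm_comp_le_one hf (hS.cbNorm_le_one (norm_synthesis_le_one hx))
  have h1 : S.norms q (γ.map formalIdentity) ≤ _ :=
    apply_le_cbNorm (N := H.dualNorms) (N' := S.norms) formalIdentity (x := γ) hg
  refine le_trans (le_of_eq ?_) ((norms_map_le S hf' _).trans h1)
  unfold matrixAlgebraNorms
  rw [matrixTensor_sum, ← ofReal_norm, ← ofReal_norm, norm_blockOp_matrix]
  congr 3
  ext1 i j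
  simp [synthesis_apply, formalIdentity_apply]

/-- If the tensors `∑_{k < n} e_k ⊗ e_k`, which represent the truncations of the formal identity,
have bounded minimal norm, then the formal identity is completely bounded. -/
lemma cbNorm_formalIdentity_le {H S : OperatorSpaceStructure ellTwo} {C : ℝ≥0}
    (h : ∀ n : ℕ, minNorm S.norms H.norms
      (∑ k : Fin n, ellTwoBasis k ⊗ₜ[ℂ] ellTwoBasis k) ≤ C) :
    cbNorm H.dualNorms S.norms formalIdentity ≤ C := by
  refine cbNorm_le fun n φ hφ => ?_
  unfold OperatorSpaceStructure.norms
  rw [← ofReal_norm, ENNReal.ofReal_le_coe]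
  refine norm_blockOp_le C.2 fun ζ ξ => ?_
  simp only [Matrix.map_apply]
  have hlim : Filter.Tendsto (fun m : ℕ => ‖∑ i, ∑ j, inner ℂ (ζ i)
      (S.rep (synthesis (fun k : Fin m => ellTwoBasis k) (formalIdentity (φ i j))) (ξ j))‖)
      Filter.atTop
      (nhds ‖∑ i, ∑ j, inner ℂ (ζ i) (S.rep (formalIdentity (φ i j)) (ξ j))‖) := by
    refine (tendsto_finsetSum _ fun i _ => tendsto_finsetSum _ fun j _ => ?_).norm
    have h1 : Continuous fun y => inner ℂ (ζ i) (S.rep y (ξ j)) := by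
      have := S.rep.continuous
      fun_prop
    exact (h1.tendsto _).comp (tendsto_synthesis_ellTwoBasis _)
  refine le_of_tendsto' hlim fun m => ?_
  refine norm_sum_inner_rep_le S
    (x := Matrix.of fun i j =>
      synthesis (fun k : Fin m => ellTwoBasis k) (formalIdentity (φ i j))) (fun p f hf => ?_) ζ ξ
  have h2 := (le_minNorm hf hφ _).trans (h m)
  rw [matrixTensor_sum, ← ofReal_norm, ENNReal.ofReal_le_coe, ← norm_blockOp_matrix] at h2
  convert h2 using 6
  simp [synthesis_apply, formalIdentity_apply]

end EllTwo

/-! ### The `ℓ`-norm on a Hilbert space -/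

section Gaussian

open MeasureTheory ProbabilityTheory

variable {E : Type*} [NormedAddCommGroup E] [InnerProductSpace ℂ E]

lemma sum_enorm_sq_rpow {E ι : Type*} [NormedAddCommGroup E] (s : Finset ι) (z : ι → E) :
    (∑ k ∈ s, ‖z k‖ₑ ^ 2) ^ (1 / 2 : ℝ) = ENNReal.ofReal √(∑ k ∈ s, ‖z k‖ ^ 2) := by
  rw [Real.sqrt_eq_rpow, ← ENNReal.ofReal_rpow_of_nonneg (by positivity) (by norm_num),
    ENNReal.ofReal_sum_of_nonneg (fun _ _ => by positivity)]
  congr 1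
  refine Finset.sum_congr rfl fun k _ => ?_
  rw [ENNReal.ofReal_pow (norm_nonneg _), ofReal_norm]

lemma integrable_gaussian_mul {n : ℕ} (k l : Fin n) :
    Integrable (fun g : Fin n → ℝ => g k * g l) (Measure.pi fun _ => gaussianReal 0 1) := by
  have h : ∀ k : Fin n, MemLp (fun g : Fin n → ℝ => g k) 2
      (Measure.pi fun _ => gaussianReal 0 1) := fun k =>
    (memLp_id_gaussianReal' 2 (by simp)).comp_measurePreserving (measurePreserving_eval _ k)
  exact (h k).integrable_mul (h l)

lemma integral_gaussian_mul {n : ℕ} (k l : Fin n) :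
    ∫ g : Fin n → ℝ, g k * g l ∂(Measure.pi fun _ => gaussianReal 0 1) =
      if k = l then 1 else 0 := by
  have h0 : ∀ k : Fin n, ∫ g : Fin n → ℝ, g k ∂(Measure.pi fun _ => gaussianReal 0 1) = 0 := by
    intro k
    rw [integral_comp_eval (μ := fun _ : Fin n => gaussianReal 0 1) (f := fun x : ℝ => x)
      aestronglyMeasurable_id]
    exact integral_id_gaussianReal
  split_ifs with h
  · subst h
    rw [integral_comp_eval (μ := fun _ : Fin n => gaussianReal 0 1) (f := fun x : ℝ => x * x)
      (by fun_prop)]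
    have hv := variance_fun_id_gaussianReal (μ := 0) (v := 1)
    rw [variance_of_integral_eq_zero (by fun_prop) integral_id_gaussianReal] at hv
    simpa [pow_two] using hv
  · have hi := iIndepFun_pi (μ := fun _ : Fin n => gaussianReal 0 1) (X := fun _ => id)
      (fun _ => aemeasurable_id)
    have := (hi.indepFun h).integral_mul_eq_mul_integral
      (measurable_pi_apply k).aestronglyMeasurable (measurable_pi_apply l).aestronglyMeasurable
    refine this.trans ?_
    simp [h0]

/-- On a Hilbert space the `ℓ`-norm is the Hilbert–Schmidt norm. -/
lemma ellNorm_eq {n : ℕ} (u : EuclideanSpace ℂ (Fin n) →L[ℂ] E) :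
    ellNorm u = ENNReal.ofReal √(∑ k, ‖u (EuclideanSpace.single k 1)‖ ^ 2) := by
  set z := fun k => u (EuclideanSpace.single k 1) with hz
  have hexp : ∀ g : Fin n → ℝ, ‖∑ k, (g k : ℂ) • z k‖ ^ 2 =
      ∑ k, ∑ l, g k * g l * (inner ℂ (z k) (z l)).re := by
    intro g
    rw [← inner_self_eq_norm_sq (𝕜 := ℂ), sum_inner, RCLike.re_eq_complex_re, Complex.re_sum]
    refine Finset.sum_congr rfl fun k _ => ?_
    rw [inner_sum, Complex.re_sum]
    refine Finset.sum_congr rfl fun l _ => ?_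
    rw [inner_smul_left, inner_smul_right, Complex.conj_ofReal, ← mul_assoc, ← Complex.ofReal_mul,
      Complex.re_ofReal_mul]
  unfold ellNorm
  rw [Real.sqrt_eq_rpow, ← ENNReal.ofReal_rpow_of_nonneg (by positivity) (by norm_num)]
  congr 1
  have h3 : ∀ g : Fin n → ℝ, ‖∑ k, (g k : ℂ) • z k‖ₑ ^ 2 =
      ENNReal.ofReal (∑ k, ∑ l, g k * g l * (inner ℂ (z k) (z l)).re) := by
    intro g
    rw [← hexp, ENNReal.ofReal_pow (norm_nonneg _), ofReal_norm]
  have hint : ∀ k l, Integrable (fun g : Fin n → ℝ => g k * g l * (inner ℂ (z k) (z l)).re)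
      (Measure.pi fun _ => gaussianReal 0 1) := fun k l => (integrable_gaussian_mul k l).mul_const _
  refine (lintegral_congr h3).trans ?_
  rw [← ofReal_integral_eq_lintegral_ofReal]
  · congr 1
    rw [integral_finsetSum _ fun k _ => integrable_finsetSum _ fun l _ => hint k l]
    refine Finset.sum_congr rfl fun k _ => ?_
    rw [integral_finsetSum _ fun l _ => hint k l]
    simp only [integral_mul_const, integral_gaussian_mul, ite_mul, one_mul, zero_mul,
      Finset.sum_ite_eq, Finset.mem_univ, if_true]
    exact inner_self_eq_norm_sq (𝕜 := ℂ) (z k)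
  · exact integrable_finsetSum _ fun k _ => integrable_finsetSum _ fun l _ => hint k l
  · exact Filter.Eventually.of_forall fun g => (sq_nonneg _).trans_eq (hexp g)

end Gaussian

/-! ### The adjoint `ℓ`-norm and the Hilbert–Schmidt norm -/

section Trace

variable {E : Type*} [NormedAddCommGroup E] [InnerProductSpace ℂ E] {n : ℕ}

lemma trace_comp_eq_sum_inner (w : E →L[ℂ] EuclideanSpace ℂ (Fin n))
    (u : EuclideanSpace ℂ (Fin n) →L[ℂ] E) :
    LinearMap.trace ℂ (EuclideanSpace ℂ (Fin n))
      (w ∘L u : EuclideanSpace ℂ (Fin n) →L[ℂ] EuclideanSpace ℂ (Fin n)) =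
    ∑ k, inner ℂ (EuclideanSpace.single k (1 : ℂ)) (w (u (EuclideanSpace.single k 1))) := by
  rw [LinearMap.trace_eq_sum_inner _ (EuclideanSpace.basisFun (Fin n) ℂ)]
  simp

/-- There is a finite orthonormal family, spanning the orthogonal complement of `ker w`, that
computes the Hilbert–Schmidt norm of `w`; and `ℓ*(w)` is at most this norm. -/
lemma exists_orthonormal_ellStar_le [CompleteSpace E] (w : E →L[ℂ] EuclideanSpace ℂ (Fin n)) :
    ∃ (d : ℕ) (x : Fin d → E), Orthonormal ℂ x ∧
      ellStar w ≤ (∑ j, ‖w (x j)‖ₑ ^ 2) ^ (1 / 2 : ℝ) := by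
  let e := EuclideanSpace.basisFun (Fin n) ℂ
  let w' := ContinuousLinearMap.adjoint w
  let V : Submodule ℂ E := LinearMap.range (w' : EuclideanSpace ℂ (Fin n) →ₗ[ℂ] E)
  let b := stdOrthonormalBasis ℂ V
  have hx : Orthonormal ℂ fun j => (b j : E) := b.orthonormal.comp_linearIsometry V.subtypeₗᵢ
  refine ⟨_, fun j => b j, hx, iSup_le fun u => iSup_le fun hu => ?_⟩
  rw [ellNorm_eq, ENNReal.ofReal_le_one] at hu
  rw [sum_enorm_sq_rpow, ← ofReal_norm]
  apply ENNReal.ofReal_le_ofReal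
  have hHS : ∑ k, ‖w' (e k)‖ ^ 2 = ∑ j, ‖w (b j)‖ ^ 2 := by
    have h1 : ∀ k, ‖w' (e k)‖ ^ 2 = ∑ j, ‖inner ℂ (b j : E) (w' (e k))‖ ^ 2 := by
      intro k
      have := b.sum_sq_norm_inner_right ⟨w' (e k), ⟨e k, rfl⟩⟩
      simpa using this.symm
    have h2 : ∀ j, ‖w (b j)‖ ^ 2 = ∑ k, ‖inner ℂ (w (b j)) (e k)‖ ^ 2 := fun j =>
      (e.sum_sq_norm_inner_left _).symm
    simp only [h1, h2]
    rw [Finset.sum_comm]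
    refine Finset.sum_congr rfl fun j _ => Finset.sum_congr rfl fun k _ => ?_
    rw [ContinuousLinearMap.adjoint_inner_right]
  rw [trace_comp_eq_sum_inner]
  calc ‖∑ k, inner ℂ (EuclideanSpace.single k (1 : ℂ)) (w (u (EuclideanSpace.single k 1)))‖
      ≤ ∑ k, ‖w' (e k)‖ * ‖u (EuclideanSpace.single k 1)‖ := by
        refine (norm_sum_le _ _).trans (Finset.sum_le_sum fun k _ => ?_)
        rw [← ContinuousLinearMap.adjoint_inner_left]
        simpa [e, w'] using norm_inner_le_norm (𝕜 := ℂ) (w' (e k)) (u (EuclideanSpace.single k 1))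
    _ ≤ √(∑ k, ‖w' (e k)‖ ^ 2) * √(∑ k, ‖u (EuclideanSpace.single k 1)‖ ^ 2) :=
        Real.sum_mul_le_sqrt_mul_sqrt _ _ _
    _ ≤ √(∑ k, ‖w' (e k)‖ ^ 2) * 1 := by gcongr
    _ = _ := by rw [mul_one, hHS]

end Trace

section Truncation

/-- The operator `ℓ₂ → ℓ₂^n` that retains the first `n` coordinates. -/
noncomputable def truncation (n : ℕ) : ellTwo →L[ℂ] EuclideanSpace ℂ (Fin n) :=
  ((EuclideanSpace.equiv (Fin n) ℂ).symm : (Fin n → ℂ) →L[ℂ] EuclideanSpace ℂ (Fin n)) ∘L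
    ContinuousLinearMap.pi fun i => lp.evalCLM ℂ (fun _ : ℕ => ℂ) 2 (i : ℕ)

lemma truncation_apply (n : ℕ) (y : ellTwo) (i : Fin n) : truncation n y i = y i := by
  simp [truncation, lp.evalCLM]

lemma sqrt_le_ellStar_truncation (n : ℕ) : ENNReal.ofReal √n ≤ ellStar (truncation n) := by
  rcases Nat.eq_zero_or_pos n with rfl | hn
  · simp
  have hn' : (0 : ℝ) < n := by exact_mod_cast hn
  -- The supremum is tested on the adjoint of the truncation, normalised in Hilbert–Schmidt norm.
  let u : EuclideanSpace ℂ (Fin n) →L[ℂ] ellTwo :=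
    ∑ i : Fin n, (EuclideanSpace.proj i : EuclideanSpace ℂ (Fin n) →L[ℂ] ℂ).smulRight
      (((√n)⁻¹ : ℂ) • ellTwoBasis i)
  have hu : ∀ k, u (EuclideanSpace.single k 1) = ((√n)⁻¹ : ℂ) • ellTwoBasis k := by
    intro k
    simp [u, ite_smul]
  have hnorm : ∀ k : ℕ, ‖((√n)⁻¹ : ℂ) • ellTwoBasis k‖ ^ 2 = (n : ℝ)⁻¹ := by
    intro k
    rw [norm_smul, orthonormal_ellTwoBasis.1 k, mul_one, norm_inv, Complex.norm_real,
      inv_pow, Real.norm_eq_abs, sq_abs, Real.sq_sqrt hn'.le]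
  have hell : ellNorm u ≤ 1 := by
    rw [ellNorm_eq, ENNReal.ofReal_le_one]
    simp [hu, hnorm, hn'.ne']
  refine le_iSup_of_le u (le_iSup_of_le hell (le_of_eq ?_))
  rw [trace_comp_eq_sum_inner]
  have : ∀ k, inner ℂ (EuclideanSpace.single k (1 : ℂ))
      (truncation n (u (EuclideanSpace.single k 1))) = ((√n)⁻¹ : ℂ) := by
    intro k
    rw [EuclideanSpace.inner_single_left, truncation_apply, hu]
    simp [ellTwoBasis_apply]
  simp only [this, Finset.sum_const, Finset.card_univ, Fintype.card_fin]
  rw [← ofReal_norm, nsmul_eq_mul, norm_mul, norm_inv, Complex.norm_real, Complex.norm_natCast,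
    Real.norm_of_nonneg (Real.sqrt_nonneg _), ← div_eq_mul_inv, Real.div_sqrt]

end Truncation

/-! ### Averaging over signed shifts -/

section Averaging

/-- The operator `e_k ↦ x̄_k` is the transpose of the adjoint of the operator `e_k ↦ x_k`, so its
norm is the injective Banach space tensor norm of `∑ x_k ⊗ e_k`. -/
lemma enorm_synthesis_star_le (S : OperatorSpaceStructure ellTwo) (H : OperatorSpaceStructure ellTwo) {m : ℕ}
    (x : Fin m → ellTwo) :
    ‖synthesis fun k => star (x k)‖ₑ ≤
      minNorm S.norms H.norms (∑ k : Fin m, x k ⊗ₜ[ℂ] ellTwoBasis k) := by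
  rcases eq_or_ne (minNorm S.norms H.norms (∑ k : Fin m, x k ⊗ₜ[ℂ] ellTwoBasis k)) ⊤ with ht | ht
  · rw [ht]; exact le_top
  rw [← ofReal_norm, ENNReal.ofReal_le_iff_le_toReal ht]
  refine ContinuousLinearMap.opNorm_le_of_unit_norm ENNReal.toReal_nonneg fun y hy => ?_
  set z : ellTwo := ∑ k : Fin m, star (y k) • x k with hz
  have h1 : synthesis (fun k => star (x k)) y = star z := by
    rw [synthesis_apply, hz, star_sum]
    simp
  obtain ⟨f, hf, hfz⟩ := exists_dual_vector'' ℂ z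
  have h2 := enorm_sum_mul_le_minNorm S H hf (g := innerSL ℂ y)
    (by rw [innerSL_apply_norm, hy]) x (fun k => ellTwoBasis k)
  have h3 : ∑ k : Fin m, f (x k) * innerSL ℂ y (ellTwoBasis k) = f z := by
    rw [hz, map_sum]
    refine Finset.sum_congr rfl fun k _ => ?_
    rw [innerSL_apply_apply, ← inner_conj_symm, inner_ellTwoBasis_left, map_smul, smul_eq_mul,
      mul_comm]
    rfl
  rw [h3, hfz, ← ofReal_norm, ENNReal.ofReal_le_iff_le_toReal ht] at h2
  rw [h1, norm_star]
  simpa using h2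

lemma minNorm_map_le_mul {S : OperatorSpaceStructure ellTwo} {H : OperatorSpaceStructure ellTwo} (hS : IsHomogeneous S)
    (hH : IsHomogeneous H) {a b : ellTwo →L[ℂ] ellTwo} (ha : ‖a‖ ≤ 1) (t : ellTwo ⊗[ℂ] ellTwo) :
    minNorm S.norms H.norms
      (TensorProduct.map (a : ellTwo →ₗ[ℂ] ellTwo) (b : ellTwo →ₗ[ℂ] ellTwo) t) ≤
      ‖b‖ₑ * minNorm S.norms H.norms t := by
  have hb : b = (‖b‖ : ℂ) • ((‖b‖⁻¹ : ℂ) • b) := by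
    rcases eq_or_ne b 0 with rfl | h
    · simp
    · rw [smul_smul, mul_inv_cancel₀ (by simpa using h), one_smul]
  have hb' : ‖(‖b‖⁻¹ : ℂ) • b‖ ≤ 1 := by
    rw [norm_smul, norm_inv, Complex.norm_real, norm_norm]
    exact inv_mul_le_one
  have h1 := minNorm_map_le (hS.cbNorm_le_one ha) (hH.cbNorm_le_one hb') t
  conv_lhs => rw [hb]
  rw [ContinuousLinearMap.toLinearMap_smul, TensorProduct.map_smul_right, LinearMap.smul_apply]
  refine (minNorm_smul_le _ _).trans ?_
  have : ‖(‖b‖ : ℂ)‖ₑ = ‖b‖ₑ := by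
    rw [← ofReal_norm, ← ofReal_norm, Complex.norm_real, norm_norm]
  rw [this]
  gcongr

lemma sum_signs_mul {n : ℕ} (i l : Fin n) :
    ∑ ε : Fin n → ℤˣ, ((ε i : ℤ) : ℂ) * ((ε l : ℤ) : ℂ) =
      if i = l then (Fintype.card (Fin n → ℤˣ) : ℂ) else 0 := by
  split_ifs with h
  · subst h
    have : ∀ ε : Fin n → ℤˣ, ((ε i : ℤ) : ℂ) * ((ε i : ℤ) : ℂ) = 1 := by
      intro ε
      rcases Int.units_eq_one_or (ε i) with h | h <;> simp [h]
    simp [this]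
  · -- Changing the sign `ε i` changes the sign of every summand.
    have h1 := Equiv.sum_comp (Equiv.mulLeft (Pi.mulSingle i (-1) : Fin n → ℤˣ))
      fun ε => ((ε i : ℤ) : ℂ) * ((ε l : ℤ) : ℂ)
    have h2 : (Pi.mulSingle i (-1) : Fin n → ℤˣ) l = 1 := Pi.mulSingle_eq_of_ne' h _
    simp only [Equiv.coe_mulLeft, Pi.mul_apply, Pi.mulSingle_eq_same, h2, one_mul, neg_mul,
      Units.val_neg, Int.cast_neg, Finset.sum_neg_distrib] at h1
    exact self_eq_neg.1 h1.symm

lemma orthonormal_signed_shift {n : ℕ} [NeZero n] (ε : Fin n → ℤˣ) (c : Fin n) :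
    Orthonormal ℂ fun i => ((ε i : ℤ) : ℂ) • ellTwoBasis (i + c : Fin n) := by
  rw [orthonormal_iff_ite]
  intro i j
  rw [inner_smul_left, inner_smul_right, inner_ellTwoBasis_left, ellTwoBasis_apply]
  simp only [Fin.val_inj, add_left_inj]
  split_ifs with h
  · subst h
    rcases Int.units_eq_one_or (ε i) with h | h <;> simp [h]
  · simp

/-- Averaging the positive operator with matrix `∑_k x_k x_k*` over the signed cyclic shifts of
the first `n` unit vectors gives a multiple of the identity with the same trace. -/
lemma sum_map_signed_shift {n m : ℕ} [NeZero n] (x : Fin m → ellTwo) :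
    ∑ ε : Fin n → ℤˣ, ∑ c : Fin n, TensorProduct.map
      (synthesis fun i => ((ε i : ℤ) : ℂ) • ellTwoBasis (i + c : Fin n) : ellTwo →ₗ[ℂ] ellTwo)
      (synthesis fun i => ((ε i : ℤ) : ℂ) • ellTwoBasis (i + c : Fin n) : ellTwo →ₗ[ℂ] ellTwo)
      (∑ k, x k ⊗ₜ[ℂ] star (x k)) =
    ((Fintype.card (Fin n → ℤˣ) * ∑ k, ‖truncation n (x k)‖ ^ 2 : ℝ) : ℂ) •
      ∑ k : Fin n, ellTwoBasis k ⊗ₜ[ℂ] ellTwoBasis k := by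
  have hshift : ∀ i : Fin n, ∑ c : Fin n,
      ellTwoBasis (i + c : Fin n) ⊗ₜ[ℂ] ellTwoBasis (i + c : Fin n) =
      ∑ k : Fin n, ellTwoBasis k ⊗ₜ[ℂ] ellTwoBasis k := fun i =>
    Equiv.sum_comp (Equiv.addLeft i) fun k : Fin n => ellTwoBasis k ⊗ₜ[ℂ] ellTwoBasis k
  set I := ∑ k : Fin n, ellTwoBasis k ⊗ₜ[ℂ] ellTwoBasis k
  have hterm : ∀ (ε : Fin n → ℤˣ) (c : Fin n), TensorProduct.map
      (synthesis fun i => ((ε i : ℤ) : ℂ) • ellTwoBasis (i + c : Fin n) : ellTwo →ₗ[ℂ] ellTwo)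
      (synthesis fun i => ((ε i : ℤ) : ℂ) • ellTwoBasis (i + c : Fin n) : ellTwo →ₗ[ℂ] ellTwo)
      (∑ k, x k ⊗ₜ[ℂ] star (x k)) =
      ∑ k, ∑ i : Fin n, ∑ l : Fin n, (x k i * star (x k l)) • (((ε i : ℤ) : ℂ) * ((ε l : ℤ) : ℂ)) •
        (ellTwoBasis (i + c : Fin n) ⊗ₜ[ℂ] ellTwoBasis (l + c : Fin n)) := by
    intro ε c
    rw [map_sum]
    refine Finset.sum_congr rfl fun k _ => ?_
    rw [TensorProduct.map_tmul]
    simp only [ContinuousLinearMap.coe_coe, synthesis_apply]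
    rw [TensorProduct.sum_tmul]
    refine Finset.sum_congr rfl fun i _ => ?_
    rw [TensorProduct.tmul_sum]
    refine Finset.sum_congr rfl fun l _ => ?_
    simp only [TensorProduct.smul_tmul_smul, smul_smul, lp.star_apply]
    congr 1
    ring
  have hk : ∀ k, ∑ ε : Fin n → ℤˣ, ∑ c : Fin n, ∑ i : Fin n, ∑ l : Fin n,
      (x k i * star (x k l)) • (((ε i : ℤ) : ℂ) * ((ε l : ℤ) : ℂ)) •
        (ellTwoBasis (i + c : Fin n) ⊗ₜ[ℂ] ellTwoBasis (l + c : Fin n)) =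
      ((Fintype.card (Fin n → ℤˣ) * ‖truncation n (x k)‖ ^ 2 : ℝ) : ℂ) • I := by
    intro k
    calc _ = ∑ i : Fin n, ∑ l : Fin n, (x k i * star (x k l)) •
          (∑ ε : Fin n → ℤˣ, ((ε i : ℤ) : ℂ) * ((ε l : ℤ) : ℂ)) •
          ∑ c : Fin n, (ellTwoBasis (i + c : Fin n) ⊗ₜ[ℂ] ellTwoBasis (l + c : Fin n)) := by
          refine (Finset.sum_congr rfl fun ε _ => Finset.sum_comm).trans (Finset.sum_comm.trans
            (Finset.sum_congr rfl fun i _ => (Finset.sum_congr rfl fun ε _ =>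
              Finset.sum_comm).trans (Finset.sum_comm.trans (Finset.sum_congr rfl fun l _ => ?_))))
          rw [Finset.sum_smul, Finset.smul_sum]
          refine Finset.sum_congr rfl fun ε _ => ?_
          rw [Finset.smul_sum, Finset.smul_sum]
      _ = ∑ i : Fin n, (x k i * star (x k i)) • (Fintype.card (Fin n → ℤˣ) : ℂ) • I := by
          refine Finset.sum_congr rfl fun i _ => ?_
          simp only [sum_signs_mul, ite_smul, zero_smul, smul_ite, smul_zero, Finset.sum_ite_eq,
            Finset.mem_univ, if_true, hshift]
      _ = _ := by
          rw [← Finset.sum_smul, smul_smul, EuclideanSpace.norm_sq_eq]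
          congr 1
          simp only [truncation_apply]
          push_cast
          rw [mul_comm]
          congr 1
          refine Finset.sum_congr rfl fun i _ => ?_
          exact Complex.mul_conj' _
  simp only [hterm]
  calc _ = ∑ k, ∑ ε : Fin n → ℤˣ, ∑ c : Fin n, ∑ i : Fin n, ∑ l : Fin n,
      (x k i * star (x k l)) • (((ε i : ℤ) : ℂ) * ((ε l : ℤ) : ℂ)) •
        (ellTwoBasis (i + c : Fin n) ⊗ₜ[ℂ] ellTwoBasis (l + c : Fin n)) :=
        (Finset.sum_congr rfl fun ε _ => Finset.sum_comm).trans Finset.sum_comm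
    _ = _ := by
        simp only [hk]
        rw [← Finset.sum_smul, ← Complex.ofReal_sum, Finset.mul_sum]

/-- If `t = ∑ x_k ⊗ e_k`, then `(∑_k ‖P_n x_k‖²) ‖∑_{k<n} e_k ⊗ e_k‖ ≤ n ‖t‖²` for minimal norms:
the positive operator `t t*` has norm at most `‖t‖²` by homogeneity, and averaging it over signed
cyclic shifts gives a multiple of the identity of `ℓ₂^n`. -/
lemma mul_minNorm_le {S : OperatorSpaceStructure ellTwo} {H : OperatorSpaceStructure ellTwo} (hS : IsHomogeneous S)
    (hH : IsHomogeneous H) {n m : ℕ} [NeZero n] (x : Fin m → ellTwo) :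
    ENNReal.ofReal (∑ k, ‖truncation n (x k)‖ ^ 2) *
        minNorm S.norms H.norms (∑ k : Fin n, ellTwoBasis k ⊗ₜ[ℂ] ellTwoBasis k) ≤
      n * minNorm S.norms H.norms (∑ k : Fin m, x k ⊗ₜ[ℂ] ellTwoBasis k) ^ 2 := by
  set A := ∑ k, ‖truncation n (x k)‖ ^ 2
  have hA : 0 ≤ A := by positivity
  set I := ∑ k : Fin n, ellTwoBasis k ⊗ₜ[ℂ] ellTwoBasis k
  set t := ∑ k : Fin m, x k ⊗ₜ[ℂ] ellTwoBasis k with ht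
  set s := ∑ k, x k ⊗ₜ[ℂ] star (x k) with hs
  set G : ℕ := Fintype.card (Fin n → ℤˣ)
  have hG : (G : ℝ≥0∞) ≠ 0 := by simp [G]
  have hst : minNorm S.norms H.norms s ≤ minNorm S.norms H.norms t ^ 2 := by
    have h1 := minNorm_map_le_mul hS hH (a := ContinuousLinearMap.id ℂ ellTwo)
      (b := synthesis fun k => star (x k)) ContinuousLinearMap.norm_id_le t
    have h2 : TensorProduct.map (ContinuousLinearMap.id ℂ ellTwo : ellTwo →ₗ[ℂ] ellTwo)
        (synthesis fun k => star (x k) : ellTwo →ₗ[ℂ] ellTwo) t = s := by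
      rw [ht, hs, map_sum]
      simp [synthesis_basis]
    rw [h2] at h1
    refine h1.trans ?_
    rw [pow_two]
    gcongr
    exact enorm_synthesis_star_le S H x
  have havg : minNorm S.norms H.norms (((G * A : ℝ) : ℂ) • I) ≤
      G * (n * minNorm S.norms H.norms s) := by
    rw [← sum_map_signed_shift (n := n) x]
    refine (minNorm_sum_le _ _).trans ((Finset.sum_le_sum fun ε _ => (minNorm_sum_le _ _).trans
      (Finset.sum_le_sum fun c _ => minNorm_map_le
        (hS.cbNorm_le_one (norm_synthesis_le_one (orthonormal_signed_shift ε c)))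
        (hH.cbNorm_le_one (norm_synthesis_le_one (orthonormal_signed_shift ε c))) s)).trans ?_)
    simp [G]
  have hscale : ENNReal.ofReal (G * A) * minNorm S.norms H.norms I ≤
      minNorm S.norms H.norms (((G * A : ℝ) : ℂ) • I) := by
    rcases (mul_nonneg G.cast_nonneg hA).eq_or_lt with h0 | h0
    · simp [← h0]
    have h1 := minNorm_smul_le (N := S.norms) (N' := H.norms) (((G * A : ℝ) : ℂ)⁻¹)
      (((G * A : ℝ) : ℂ) • I)
    have hne : ((G * A : ℝ) : ℂ) ≠ 0 := by exact_mod_cast h0.ne'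
    rw [smul_smul, inv_mul_cancel₀ hne, one_smul] at h1
    have h2 : ‖((G * A : ℝ) : ℂ)⁻¹‖ₑ = (ENNReal.ofReal (G * A))⁻¹ := by
      rw [← ofReal_norm, norm_inv, Complex.norm_real, Real.norm_of_nonneg h0.le,
        ENNReal.ofReal_inv_of_pos h0]
    rw [h2] at h1
    calc _ ≤ ENNReal.ofReal (G * A) * ((ENNReal.ofReal (G * A))⁻¹ * _) := by gcongr
      _ = _ := by
        rw [← mul_assoc, ENNReal.mul_inv_cancel (ENNReal.ofReal_pos.2 h0).ne' ENNReal.ofReal_ne_top, one_mul]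
  have := hscale.trans havg
  rw [ENNReal.ofReal_mul G.cast_nonneg, ENNReal.ofReal_natCast, mul_assoc,
    ENNReal.mul_le_mul_iff_right hG (ENNReal.natCast_ne_top G)] at this
  refine this.trans ?_
  gcongr

/-- Cotype `(2,H)` with constant `C` bounds the truncations of the formal identity by `(2C)²`. -/
lemma HasCotypeTwo.exists_minNorm_le {S : OperatorSpaceStructure ellTwo} {H : OperatorSpaceStructure ellTwo}
    (hS : IsHomogeneous S) (hH : IsHomogeneous H) (h : HasCotypeTwo H S) :
    ∃ C : ℝ≥0, ∀ n : ℕ, minNorm S.norms H.norms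
      (∑ k : Fin n, ellTwoBasis k ⊗ₜ[ℂ] ellTwoBasis k) ≤ C := by
  obtain ⟨C, hC, h⟩ := h
  refine ⟨(2 * C) ^ 2, fun n => ?_⟩
  rcases Nat.eq_zero_or_pos n with rfl | hn
  · have := minNorm_smul_le (N := S.norms) (N' := H.norms) 0 (0 : ellTwo ⊗[ℂ] ellTwo)
    simp only [smul_zero, enorm_zero, zero_mul] at this
    simp only [Finset.univ_eq_empty, Finset.sum_empty]
    exact this.trans (zero_le)
  have : NeZero n := ⟨hn.ne'⟩
  have hn' : (0 : ℝ) < n := by exact_mod_cast hn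
  have h1 := (sqrt_le_ellStar_truncation n).trans (h n (truncation n))
  -- Some family `x` nearly attains the `(2,H)`-summing norm of the truncation; the factor `2`
  -- makes the inequality strict.
  have h2 : ENNReal.ofReal √n / (2 * C) < piTwo H S (truncation n) := by
    have hC0 : (C : ℝ≥0∞) ≠ 0 := by exact_mod_cast hC.ne'
    have hpos : ENNReal.ofReal √n ≠ 0 := by simpa using Real.sqrt_pos.2 hn'
    have hlt : ENNReal.ofReal √n / 2 < ENNReal.ofReal √n :=
      ENNReal.half_lt_self hpos ENNReal.ofReal_ne_top
    by_contra! hle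
    have h3 : (C : ℝ≥0∞) * (ENNReal.ofReal √n / (2 * C)) = ENNReal.ofReal √n / 2 := by
      rw [← mul_div_assoc, mul_comm, ENNReal.mul_div_mul_right _ _ hC0 ENNReal.coe_ne_top]
    have : (C : ℝ≥0∞) * piTwo H S (truncation n) ≤ ENNReal.ofReal √n / 2 := by
      rw [← h3]; gcongr
    exact absurd (h1.trans this) (not_le.2 hlt)
  obtain ⟨m, h2⟩ := lt_iSup_iff.1 h2
  obtain ⟨x, h2⟩ := lt_iSup_iff.1 h2
  rw [sum_enorm_sq_rpow] at h2
  have h4 := mul_minNorm_le hS hH (n := n) x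
  set A := ∑ k, ‖truncation n (x k)‖ ^ 2
  have hA : 0 < A := by
    refine lt_of_le_of_ne (by positivity) fun h0 => ?_
    simp [← h0] at h2
  set I := minNorm S.norms H.norms (∑ k : Fin n, ellTwoBasis k ⊗ₜ[ℂ] ellTwoBasis k)
  set t := minNorm S.norms H.norms (∑ k : Fin m, x k ⊗ₜ[ℂ] ellTwoBasis k)
  have h5 : ENNReal.ofReal √n / (2 * C) * t ≤ ENNReal.ofReal √A := ENNReal.mul_le_of_le_div h2.le
  have h6 : ENNReal.ofReal √n * t ≤ 2 * C * ENNReal.ofReal √A := by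
    have h20 : (2 * C : ℝ≥0∞) ≠ 0 := by exact_mod_cast (mul_pos two_pos hC).ne'
    have h2t : (2 * C : ℝ≥0∞) ≠ ⊤ := by exact_mod_cast ENNReal.coe_ne_top (r := 2 * C)
    rw [← ENNReal.mul_div_cancel h20 h2t (b := ENNReal.ofReal √n), mul_assoc]
    gcongr
  have h7 : (n : ℝ≥0∞) * t ^ 2 ≤ (2 * C) ^ 2 * ENNReal.ofReal A := by
    have h8 : ∀ r : ℝ, 0 ≤ r → ENNReal.ofReal √r ^ 2 = ENNReal.ofReal r := fun r hr => by
      rw [← ENNReal.ofReal_pow (Real.sqrt_nonneg _), Real.sq_sqrt hr]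
    have := pow_le_pow_left' h6 2
    rwa [mul_pow, mul_pow, h8 _ hn'.le, h8 _ hA.le, ENNReal.ofReal_natCast] at this
  have h9 := h4.trans h7
  rw [mul_comm, ENNReal.mul_le_mul_iff_left (by simpa using hA) ENNReal.ofReal_ne_top] at h9
  exact_mod_cast h9

end Averaging

/-! ### Cotype and complete boundedness -/

/-- If the formal identity is completely bounded, then the orthonormal family that computes the
Hilbert–Schmidt norm of `w` is a test family for the `(2,H)`-summing norm of `w`. -/
lemma hasCotypeTwo_of_isCompletelyBounded {S : OperatorSpaceStructure ellTwo} {H : OperatorSpaceStructure ellTwo}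
    (hS : IsHomogeneous S) (h : IsCompletelyBounded H.dualNorms S.norms formalIdentity) :
    HasCotypeTwo H S := by
  refine ⟨(cbNorm H.dualNorms S.norms formalIdentity).toNNReal + 1, by positivity, fun n w => ?_⟩
  obtain ⟨d, x, hx, hw⟩ := exists_orthonormal_ellStar_le w
  refine hw.trans ?_
  set a := (∑ j, ‖w (x j)‖ₑ ^ 2) ^ (1 / 2 : ℝ)
  have hb := minNorm_le_cbNorm_formalIdentity (H := H) hS hx
  set b := minNorm S.norms H.norms (∑ k : Fin d, x k ⊗ₜ[ℂ] ellTwoBasis k) with hbdef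
  have hab : a / b ≤ piTwo H S w := le_iSup_of_le d (le_iSup_of_le x le_rfl)
  have hC : b ≤ ((cbNorm H.dualNorms S.norms formalIdentity).toNNReal + 1 : ℝ≥0) := by
    rw [ENNReal.coe_add, ENNReal.coe_toNNReal h.ne]
    exact hb.trans le_self_add
  have hbtop : b ≠ ⊤ := (hb.trans_lt h).ne
  calc a ≤ ((cbNorm H.dualNorms S.norms formalIdentity).toNNReal + 1 : ℝ≥0) * (a / b) := by
        rcases eq_or_ne b 0 with h0 | h0
        · rcases eq_or_ne a 0 with ha | ha
          · rw [ha]; exact zero_le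
          · rw [h0, ENNReal.div_zero ha, ENNReal.mul_top (by simp)]
            exact le_top
        · calc a = b * (a / b) := (ENNReal.mul_div_cancel h0 hbtop).symm
            _ ≤ _ := by gcongr
    _ ≤ _ := by gcongr

end OpSpace

theorem mainTheorem10
    (H : OpSpace.OperatorSpaceStructure ellTwo) (hH : OpSpace.IsHomogeneous H)
    (𝓗 : OpSpace.OperatorSpaceStructure ellTwo) (h𝓗 : OpSpace.IsHomogeneous 𝓗) :
    OpSpace.HasCotypeTwo H 𝓗 ↔
      OpSpace.IsCompletelyBounded H.dualNorms 𝓗.norms OpSpace.formalIdentity := by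
  refine ⟨fun h => ?_, OpSpace.hasCotypeTwo_of_isCompletelyBounded h𝓗⟩
  obtain ⟨C, hC⟩ := h.exists_minNorm_le h𝓗 hH
  exact (OpSpace.cbNorm_formalIdentity_le hC).trans_lt ENNReal.coe_lt_top
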